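/- Let $G$ be a finite simple graph without isolated vertices. For $p,q\ge 0$ let $\hbar(p,q)=(p+q)\,h\!\left(\frac{p}{p+q}\right)$, where $h(x)=-x\log_2 x-(1-x)\log_2(1-x)$ is the binary entropy (with $\hbar(p,q)=0$ if $p=0$ or $q=0$). A probability distribution $P$ on $V(G)$ is called $G$-balanced if it maximizes $$l(G,P)=\min_{\{x,y\}\in E(G)}\hbar(P(x),P(y))$$ among all probability distributions on $V(G)$. A vertex is critical if its deletion strictly decreases the stability number $\alpha(G)$ (the maximum size of a set of pairwise non-adjacent vertices); equivalently, if it lies in every stable set of maximum size. Given a distribution $P$, a vertex $x$ is $P$-critical if $P(x)<P(y)$ for every neighbour $y$ of $x$. For $X\subseteq V(G)$, let $\Gamma X$ be the set of vertices outside $X$ that are adjacent to some vertex of $X$. A perfect 2-matching of a graph is an assignment of weights in $\{0,\tfrac12,1\}$ to its edges such that the weights of the edges at each vertex sum to $1$ (equivalently, the vertex set is covered by vertex-disjoint edges and odd cycles of the graph). Splitting Lemma. Let $P$ be a $G$-balanced distribution. Then: 1. every $P$-critical vertex is critical; 2. if $X$ is the set of the $P$-critical vertices, then the induced subgraph $F=G-(X\cup\Gamma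 X)$ has a perfect 2-matching. -/

import Mathlib

namespace SplittingLemma

/-- The binary entropy function, with logarithms to the base 2. -/
noncomputable def binEntropy₂ (x : ℝ) : ℝ :=
  -x * Real.logb 2 x - (1 - x) * Real.logb 2 (1 - x)

/-- The function `ℏ(p, q) = (p + q) h(p / (p + q))`. Its value is `0` when `p ≥ 0`, `q ≥ 0` and one
of them vanishes, which is the continuous extension to the boundary. -/
noncomputable def hbar (p q : ℝ) : ℝ :=
  (p + q) * binEntropy₂ (p / (p + q))

variable {V : Type*}

/-- `l(G, P)`, the minimum of `ℏ(P x, P y)` over the edges `{x, y}` of `G`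
(`ℏ` is symmetric, so the order of the endpoints is irrelevant). -/
noncomputable def edgeMin (G : SimpleGraph V) (P : V → ℝ) : ℝ :=
  sInf {r : ℝ | ∃ x y : V, G.Adj x y ∧ r = hbar (P x) (P y)}

/-- `P` is a probability distribution on the vertices that maximizes `l(G, ·)` among all
probability distributions on the vertices. -/
def IsBalanced [Fintype V] (G : SimpleGraph V) (P : V → ℝ) : Prop :=
  P ∈ stdSimplex ℝ V ∧ IsMaxOn (edgeMin G) (stdSimplex ℝ V) P

/-- A vertex is critical if its deletion strictly decreases the stability number. -/
def IsCritical (G : SimpleGraph V) (x : V) : Prop :=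
  (G.induce ({x}ᶜ : Set V)).indepNum < G.indepNum

/-- The set of `P`-critical vertices: those which are strictly less probable than each of their
neighbours. -/
def criticalSet (G : SimpleGraph V) (P : V → ℝ) : Set V :=
  {x | ∀ y, G.Adj x y → P x < P y}

/-- `ΓX`, the set of vertices outside `X` that are adjacent to some vertex of `X`. -/
def outerNbhd (G : SimpleGraph V) (X : Set V) : Set V :=
  {y | y ∉ X ∧ ∃ x ∈ X, G.Adj x y}

/-- The sum of the weights of the edges incident with the vertex `v`. -/
noncomputable def incidentWeight (G : SimpleGraph V) (w : G.edgeSet → ℝ) (v : V) : ℝ :=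
  ∑ᶠ (e : G.edgeSet) (_ : v ∈ (e : Sym2 V)), w e

/-- A 2-matching: edge weights in `{0, 1/2, 1}` whose sum at every vertex is at most `1`. -/
def IsTwoMatching (G : SimpleGraph V) (w : G.edgeSet → ℝ) : Prop :=
  (∀ e, w e = 0 ∨ w e = 1 / 2 ∨ w e = 1) ∧ ∀ v, incidentWeight G w v ≤ 1

/-- `G` has a perfect 2-matching: a 2-matching in which the weights of the edges at every vertex
sum to `1`. For a finite graph this means that the vertices are covered by vertex-disjoint edges
and odd cycles of the graph. -/
def HasPerfectTwoMatching (G : SimpleGraph V) : Prop :=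
  ∃ w : G.edgeSet → ℝ, IsTwoMatching G w ∧ ∀ v, incidentWeight G w v = 1

end SplittingLemma

namespace SplittingLemma

/-! ### Calculus of `hbar`: derivatives and monotonicity -/

section Hbar

/-! Since `hbar` is homogeneous of degree 1, a balanced `P` minimizes total mass among positive
weightings whose edge values are all at least `edgeMin G P`. Hence a perturbation `Q` that vanishes
at both ends of a tight edge, or raises its value to first order, for every tight edge, has
nonnegative sum (`IsBalanced.sum_nonneg`). Both parts test this with weighted indicator functions.

Critical vertices: `hbar` is more sensitive to its smaller argument, so raising critical vertices
pays for lowering their neighbours almost one for one. This gives a strict Hall-type inequality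
(`IsBalanced.card_lt_card`), which lets any stable set missing a critical vertex be enlarged by
exchange.

Outside `X ∪ ΓX`, tight edges join equally probable vertices, so only the sign of `Q x + Q y`
matters. This yields Hall's condition for neighbourhoods in `F`, hence a permutation moving each
vertex to a neighbour, hence a perfect 2-matching. -/

theorem hbar_eq {p q : ℝ} (hp : 0 < p) (hq : 0 < q) :
    hbar p q = (p * Real.log ((p + q) / p) + q * Real.log ((p + q) / q)) / Real.log 2 := by
  have hpq : 0 < p + q := add_pos hp hq
  have h1 : 1 - p / (p + q) = q / (p + q) := by field_simp; ring
  unfold hbar binEntropy₂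
  rw [h1, Real.logb, Real.logb, Real.log_div hp.ne' hpq.ne', Real.log_div hq.ne' hpq.ne',
    Real.log_div hpq.ne' hp.ne', Real.log_div hpq.ne' hq.ne']
  field_simp
  ring

theorem hbar_eq_negMulLog {p q : ℝ} (hp : 0 < p) (hq : 0 < q) :
    hbar p q = (Real.negMulLog p + Real.negMulLog q - Real.negMulLog (p + q)) / Real.log 2 := by
  have hpq : 0 < p + q := add_pos hp hq
  rw [hbar_eq hp hq, Real.log_div hpq.ne' hp.ne', Real.log_div hpq.ne' hq.ne']
  simp only [Real.negMulLog]
  ring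

theorem hbar_comm {p q : ℝ} (hp : 0 < p) (hq : 0 < q) : hbar p q = hbar q p := by
  rw [hbar_eq_negMulLog hp hq, hbar_eq_negMulLog hq hp, add_comm p q]
  ring

theorem hbar_zero_left (q : ℝ) : hbar 0 q = 0 := by
  simp [hbar, binEntropy₂]

theorem hbar_mul {c : ℝ} (hc : c ≠ 0) (p q : ℝ) : hbar (c * p) (c * q) = c * hbar p q := by
  unfold hbar
  rw [← mul_add, mul_div_mul_left _ _ hc, mul_assoc]

theorem log_add_div_pos {p q : ℝ} (hp : 0 < p) (hq : 0 < q) : 0 < Real.log ((p + q) / p) :=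
  Real.log_pos <| by rw [lt_div_iff₀ hp]; linarith

theorem hbar_pos {p q : ℝ} (hp : 0 < p) (hq : 0 < q) : 0 < hbar p q := by
  rw [hbar_eq hp hq]
  have h1 := log_add_div_pos hp hq
  have h2 := log_add_div_pos hq hp
  rw [add_comm q p] at h2
  have := Real.log_pos one_lt_two
  positivity

/-- In the `negMulLog` form, the constant terms `-1` of the three derivatives cancel. The smaller
argument gets the larger coefficient, which drives the exchange arguments. -/
theorem hasDerivAt_hbar_line {p q : ℝ} (hp : 0 < p) (hq : 0 < q) (a b : ℝ) :
    HasDerivAt (fun t : ℝ => hbar (p + t * a) (q + t * b))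
      ((a * Real.log ((p + q) / p) + b * Real.log ((p + q) / q)) / Real.log 2) 0 := by
  have hpq : 0 < p + q := add_pos hp hq
  have line : ∀ c d : ℝ, HasDerivAt (fun t : ℝ => c + t * d) d 0 := fun c d => by
    simpa using ((hasDerivAt_id (0 : ℝ)).mul_const d).const_add c
  have comp : ∀ c d : ℝ, 0 < c →
      HasDerivAt (fun t : ℝ => Real.negMulLog (c + t * d)) ((-Real.log c - 1) * d) 0 := by
    intro c d hc
    have h := Real.hasDerivAt_negMulLog hc.ne'
    have h' : HasDerivAt Real.negMulLog (-Real.log c - 1) (c + 0 * d) := by simpa using h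
    exact h'.comp (0 : ℝ) (line c d)
  have key := (((comp p a hp).add (comp q b hq)).sub (comp (p + q) (a + b) hpq)).div_const
    (Real.log 2)
  have ev : ∀ c d : ℝ, 0 < c → ∀ᶠ t in nhds (0 : ℝ), 0 < c + t * d := fun c d hc =>
    (line c d).continuousAt.eventually (lt_mem_nhds (by simpa using hc))
  refine (key.congr_of_eventuallyEq ?_).congr_deriv ?_
  · filter_upwards [ev p a hp, ev q b hq] with t h1 h2
    rw [hbar_eq_negMulLog h1 h2]
    simp only [Pi.add_apply, Pi.sub_apply]
    congr 3
    ring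
  · rw [Real.log_div hpq.ne' hp.ne', Real.log_div hpq.ne' hq.ne']
    ring

theorem hbar_strictMonoOn_right {p : ℝ} (hp : 0 < p) :
    StrictMonoOn (hbar p) (Set.Ioi 0) := by
  have der : ∀ q ∈ Set.Ioi (0 : ℝ),
      HasDerivAt (hbar p) (Real.log ((p + q) / q) / Real.log 2) q := by
    intro q hq
    have h := hasDerivAt_hbar_line hp hq 0 1
    simp only [mul_zero, add_zero, mul_one, zero_mul, zero_add, one_mul] at h
    have h' : HasDerivAt (fun t : ℝ => hbar p (q + t)) (Real.log ((p + q) / q) / Real.log 2)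
      (q - q) := by simpa using h
    have := HasDerivAt.comp (h₂ := fun t : ℝ => hbar p (q + t)) (h := fun t : ℝ => t - q) q h'
      ((hasDerivAt_id q).sub_const q)
    simpa [Function.comp_def] using this
  refine strictMonoOn_of_deriv_pos (convex_Ioi 0)
    (fun q hq => (der q hq).continuousAt.continuousWithinAt) fun q hq => ?_
  rw [interior_Ioi] at hq
  rw [(der q hq).deriv, add_comm]
  exact div_pos (log_add_div_pos hq hp) (Real.log_pos one_lt_two)

theorem le_of_hbar_le {p q r : ℝ} (hp : 0 < p) (hq : 0 < q) (hr : 0 < r)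
    (h : hbar p q ≤ hbar p r) : q ≤ r :=
  ((hbar_strictMonoOn_right hp).le_iff_le hq hr).1 h

end Hbar

/-! ### First-order optimality of balanced distributions -/

section Balanced

theorem not_adj_of_mem_criticalSet {V : Type*} {G : SimpleGraph V} {P : V → ℝ}
    {x y : V} (hx : x ∈ criticalSet G P)
    (hy : y ∈ criticalSet G P) : ¬ G.Adj x y := fun h =>
  (hx y h).asymm (hy x h.symm)

variable [Fintype V] {G : SimpleGraph V} {P : V → ℝ}

theorem finite_edgeValues (G : SimpleGraph V) (P : V → ℝ) :
    {r : ℝ | ∃ x y : V, G.Adj x y ∧ r = hbar (P x) (P y)}.Finite := by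
  refine (Set.finite_range fun z : V × V => hbar (P z.1) (P z.2)).subset ?_
  rintro _ ⟨x, y, -, rfl⟩
  exact ⟨(x, y), rfl⟩

theorem edgeMin_le (P : V → ℝ) {x y : V} (h : G.Adj x y) : edgeMin G P ≤ hbar (P x) (P y) :=
  csInf_le (finite_edgeValues G P).bddBelow ⟨x, y, h, rfl⟩

theorem lt_edgeMin (P : V → ℝ) {c : ℝ} {x y : V} (hxy : G.Adj x y)
    (h : ∀ x y, G.Adj x y → c < hbar (P x) (P y)) : c < edgeMin G P := by
  have hne : {r : ℝ | ∃ x y : V, G.Adj x y ∧ r = hbar (P x) (P y)}.Nonempty := ⟨_, x, y, hxy, rfl⟩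
  obtain ⟨u, v, huv, he⟩ := hne.csInf_mem (finite_edgeValues G P)
  rw [edgeMin, he]
  exact h u v huv

theorem IsBalanced.nonempty (hP : IsBalanced G P) : Nonempty V := by
  by_contra h
  rw [not_nonempty_iff] at h
  simpa using hP.1.2

/-- The uniform distribution already has a positive minimum. -/
theorem IsBalanced.edgeMin_pos (hG : ∀ x : V, ∃ y : V, G.Adj x y) (hP : IsBalanced G P) :
    0 < edgeMin G P := by
  obtain ⟨x⟩ := hP.nonempty
  obtain ⟨y, hxy⟩ := hG x
  have hc : (0 : ℝ) < (Fintype.card V : ℝ) := by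
    exact_mod_cast Fintype.card_pos_iff.2 ⟨x⟩
  have hu : (fun _ : V => (Fintype.card V : ℝ)⁻¹) ∈ stdSimplex ℝ V :=
    ⟨fun _ => by positivity, by simp [hc.ne']⟩
  exact (lt_edgeMin _ hxy fun _ _ _ => hbar_pos (inv_pos.2 hc) (inv_pos.2 hc)).trans_le (hP.2 hu)

theorem IsBalanced.pos (hG : ∀ x : V, ∃ y : V, G.Adj x y) (hP : IsBalanced G P) (x : V) :
    0 < P x := by
  obtain ⟨y, hxy⟩ := hG x
  refine (hP.1.1 x).lt_of_ne fun h => ?_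
  have h1 := (hP.edgeMin_pos hG).trans_le (edgeMin_le P hxy)
  rw [← h, hbar_zero_left] at h1
  exact h1.false

/-- A balanced distribution has the least total mass among the positive weightings whose edge
values are all at least `edgeMin G P`. -/
theorem IsBalanced.one_le_sum (hG : ∀ x : V, ∃ y : V, G.Adj x y) (hP : IsBalanced G P)
    {R : V → ℝ} (hR : ∀ x, 0 < R x)
    (h : ∀ x y, G.Adj x y → edgeMin G P ≤ hbar (R x) (R y)) : 1 ≤ ∑ x, R x := by
  by_contra! hs
  obtain ⟨x⟩ := hP.nonempty
  obtain ⟨y, hxy⟩ := hG x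
  have hpos : 0 < ∑ x, R x := Finset.sum_pos (fun x _ => hR x) ⟨x, Finset.mem_univ x⟩
  set s := ∑ x, R x with hsdef
  -- If the mass `s` were below 1, normalizing would multiply every edge value by `s⁻¹ > 1` and beat
  -- `P`.
  have hmem : (fun v => s⁻¹ * R v) ∈ stdSimplex ℝ V :=
    ⟨fun v => by have := hR v; positivity, by
      rw [← Finset.mul_sum, ← hsdef, inv_mul_cancel₀ hpos.ne']⟩
  refine (hP.2 hmem).not_gt (lt_edgeMin _ hxy fun u v huv => ?_)
  rw [hbar_mul (inv_ne_zero hpos.ne')]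
  have h1 : 1 < s⁻¹ := (one_lt_inv₀ hpos).2 hs
  have h2 := h u v huv
  nlinarith [hP.edgeMin_pos hG]

/-- First-order optimality: a direction that does not decrease any tight edge to first order
does not decrease the total mass. -/
theorem IsBalanced.sum_nonneg (hG : ∀ x : V, ∃ y : V, G.Adj x y) (hP : IsBalanced G P)
    (Q : V → ℝ)
    (h : ∀ x y, G.Adj x y → hbar (P x) (P y) = edgeMin G P →
      (Q x = 0 ∧ Q y = 0) ∨
      0 < Q x * Real.log ((P x + P y) / P x) + Q y * Real.log ((P x + P y) / P y)) :
    0 ≤ ∑ x, Q x := by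
  have hpos := hP.pos hG
  have ev1 : ∀ᶠ t in nhdsWithin (0 : ℝ) (Set.Ioi 0), ∀ x, 0 < P x + t * Q x := by
    refine Filter.eventually_all.2 fun x => Filter.Eventually.filter_mono nhdsWithin_le_nhds ?_
    have hc : ContinuousAt (fun t : ℝ => P x + t * Q x) 0 := by fun_prop
    exact hc.eventually (lt_mem_nhds (by simpa using hpos x))
  have ev2 : ∀ᶠ t in nhdsWithin (0 : ℝ) (Set.Ioi 0), ∀ x y, G.Adj x y →
      edgeMin G P ≤ hbar (P x + t * Q x) (P y + t * Q y) := by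
    refine Filter.eventually_all.2 fun x => Filter.eventually_all.2 fun y =>
      Filter.eventually_imp_distrib_left.2 fun hxy => ?_
    have hd := hasDerivAt_hbar_line (hpos x) (hpos y) (Q x) (Q y)
    -- Slack edges stay above the minimum by continuity; tight ones are either unchanged or have
    -- positive derivative.
    rcases (edgeMin_le P hxy).lt_or_eq with hlt | heq
    · refine Filter.Eventually.filter_mono nhdsWithin_le_nhds ?_
      filter_upwards [hd.continuousAt.eventually (lt_mem_nhds (a := edgeMin G P)
        (by simpa using hlt))] with t ht using ht.le
    · rcases h x y hxy heq.symm with ⟨h1, h2⟩ | hp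
      · simp [h1, h2, heq.le]
      · have hs := (hasDerivWithinAt_iff_tendsto_slope' (by simp)).1
          (hd.hasDerivWithinAt (s := Set.Ioi 0))
        filter_upwards [hs.eventually (lt_mem_nhds (div_pos hp (Real.log_pos one_lt_two))),
          self_mem_nhdsWithin] with t ht ht0
        rw [slope_def_field] at ht
        have ht0' : 0 < t - 0 := by simpa using ht0
        have := (div_pos_iff_of_pos_right ht0').1 ht
        simp only [zero_mul, add_zero] at this
        linarith
  obtain ⟨t, ⟨h1, h2⟩, ht⟩ := ((ev1.and ev2).and self_mem_nhdsWithin).exists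
  have ht : 0 < t := ht
  have hs := hP.one_le_sum hG h1 h2
  rw [Finset.sum_add_distrib, hP.1.2, ← Finset.mul_sum] at hs
  exact nonneg_of_mul_nonneg_right (by linarith) ht

/-! ### Tight edges and exchange arguments -/

/-- A vertex `x` is critical if `ℏ(P x, P y)` is the minimum for some heavier `y`, in particular
if it is the lighter end of a tight edge. -/
theorem IsBalanced.mem_criticalSet_of_tight (hG : ∀ x : V, ∃ y : V, G.Adj x y)
    (hP : IsBalanced G P) {x y : V} (ht : hbar (P x) (P y) = edgeMin G P)
    (hlt : P x < P y) : x ∈ criticalSet G P := fun z hxz =>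
  have hpos := hP.pos hG
  hlt.trans_le <| le_of_hbar_le (hpos x) (hpos y) (hpos z) (ht.trans_le (edgeMin_le P hxz))

/-- A tight edge at a neighbour of a critical vertex leads to a critical vertex. -/
theorem IsBalanced.mem_criticalSet_of_tight_of_adj (hG : ∀ x : V, ∃ y : V, G.Adj x y)
    (hP : IsBalanced G P) {x y z : V} (hx : x ∈ criticalSet G P) (hxy : G.Adj x y)
    (ht : hbar (P y) (P z) = edgeMin G P) : z ∈ criticalSet G P := by
  have hpos := hP.pos hG
  refine hP.mem_criticalSet_of_tight hG ((hbar_comm (hpos z) (hpos y)).trans ht) ?_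
  -- Comparing `{y, z}` with `{y, x}` at the common end `y` gives `P z ≤ P x < P y`.
  exact (le_of_hbar_le (hpos y) (hpos z) (hpos x)
    (ht.trans_le (edgeMin_le P hxy.symm))).trans_lt (hx y hxy)

/-- A nonempty set `A` of critical vertices is larger than any set `B` of neighbours of `A` whose
only critical neighbours lie in `A`. -/
theorem IsBalanced.card_lt_card (hG : ∀ x : V, ∃ y : V, G.Adj x y) (hP : IsBalanced G P)
    {A B : Finset V} (hA : A.Nonempty) (hAX : ∀ a ∈ A, a ∈ criticalSet G P)
    (hAB : Disjoint A B) (hB : ∀ b ∈ B, ∃ a ∈ A, G.Adj a b)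
    (hBX : ∀ b ∈ B, ∀ z ∈ criticalSet G P, G.Adj b z → z ∈ A) : B.card < A.card := by
  classical
  by_contra! hle
  have hpos := hP.pos hG
  have ev : ∀ᶠ e in nhdsWithin (0 : ℝ) (Set.Ioi 0), ∀ x y, P x < P y →
      0 < (1 - e) * Real.log ((P x + P y) / P x) - Real.log ((P x + P y) / P y) := by
    refine Filter.eventually_all.2 fun x => Filter.eventually_all.2 fun y =>
      Filter.eventually_imp_distrib_left.2 fun hxy =>
        Filter.Eventually.filter_mono nhdsWithin_le_nhds ?_
    have hc : ContinuousAt (fun e : ℝ => (1 - e) * Real.log ((P x + P y) / P x) -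
        Real.log ((P x + P y) / P y)) 0 := by fun_prop
    refine hc.eventually (lt_mem_nhds ?_)
    have hx := hpos x
    have hy := hpos y
    have : Real.log ((P x + P y) / P y) < Real.log ((P x + P y) / P x) :=
      Real.log_lt_log (by positivity) (div_lt_div_of_pos_left (by positivity) hx hxy)
    linarith
  have ev1 : ∀ᶠ e in nhdsWithin (0 : ℝ) (Set.Ioi 0), e < 1 :=
    Filter.Eventually.filter_mono nhdsWithin_le_nhds (gt_mem_nhds one_pos)
  obtain ⟨e, ⟨he, he1⟩, he0⟩ := ((ev.and ev1).and self_mem_nhdsWithin).exists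
  have he0 : 0 < e := he0
  -- The loss `e` makes the sum negative even when `A` and `B` have equal size.
  set Q : V → ℝ := fun v => (if v ∈ A then 1 - e else 0) - if v ∈ B then 1 else 0 with hQ
  have hnot : ∀ {v}, v ∈ A → v ∉ B := fun ha hb => Finset.disjoint_left.1 hAB ha hb
  have hQA : ∀ v ∈ A, Q v = 1 - e := fun v hv => by simp [hQ, hv, hnot hv]
  have hQB : ∀ v ∈ B, Q v = -1 := fun v hv => by
    have hvA : v ∉ A := fun h => hnot h hv
    simp [hQ, hv, hvA]
  have hQ0 : ∀ v, v ∉ A → v ∉ B → Q v = 0 := fun v h1 h2 => by simp [hQ, h1, h2]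
  have fromA : ∀ x y, G.Adj x y → x ∈ A →
      0 < Q x * Real.log ((P x + P y) / P x) + Q y * Real.log ((P x + P y) / P y) := by
    intro x y hxy hx
    have hyA : y ∉ A := fun hy => not_adj_of_mem_criticalSet (hAX x hx) (hAX y hy) hxy
    by_cases hy : y ∈ B
    · rw [hQA x hx, hQB y hy]
      linarith [he x y (hAX x hx y hxy)]
    · rw [hQA x hx, hQ0 y hyA hy, zero_mul, add_zero]
      exact mul_pos (by linarith) (log_add_div_pos (hpos x) (hpos y))
  have fromB : ∀ x y, G.Adj x y → hbar (P x) (P y) = edgeMin G P → x ∈ B → y ∈ A := by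
    intro x y hxy ht hx
    obtain ⟨a, ha, hax⟩ := hB x hx
    exact hBX x hx y (hP.mem_criticalSet_of_tight_of_adj hG (hAX a ha) hax ht) hxy
  have swap : ∀ x y, G.Adj x y → y ∈ A →
      0 < Q x * Real.log ((P x + P y) / P x) + Q y * Real.log ((P x + P y) / P y) := by
    intro x y hxy hy
    have := fromA y x hxy.symm hy
    rw [add_comm (P y) (P x)] at this
    linarith
  have hsum := hP.sum_nonneg hG Q fun x y hxy ht => by
    by_cases hxA : x ∈ A
    · exact .inr (fromA x y hxy hxA)
    by_cases hyA : y ∈ A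
    · exact .inr (swap x y hxy hyA)
    have hxB : x ∉ B := fun hx => hyA (fromB x y hxy ht hx)
    have hyB : y ∉ B := fun hy =>
      hxA (fromB y x hxy.symm ((hbar_comm (hpos y) (hpos x)).trans ht) hy)
    exact .inl ⟨hQ0 x hxA hxB, hQ0 y hyA hyB⟩
  simp only [hQ, Finset.sum_sub_distrib, Finset.sum_ite_mem, Finset.univ_inter, Finset.sum_const,
    nsmul_eq_mul, mul_one] at hsum
  have h1 : (0 : ℝ) < A.card := by exact_mod_cast hA.card_pos
  have h2 : (A.card : ℝ) ≤ B.card := by exact_mod_cast hle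
  nlinarith

/-- Otherwise, let `A` be the critical vertices missing from `S` and `B` the neighbours of `A` in
`S`. Critical vertices are pairwise non-adjacent, so replacing `B` by the larger `A` gives a bigger
stable set. -/
theorem IsBalanced.mem_of_isNIndepSet (hG : ∀ x : V, ∃ y : V, G.Adj x y) (hP : IsBalanced G P)
    {S : Finset V} (hS : G.IsNIndepSet G.indepNum S) {x : V} (hx : x ∈ criticalSet G P) :
    x ∈ S := by
  classical
  by_contra hxS
  set A : Finset V := Finset.univ.filter fun v => v ∈ criticalSet G P ∧ v ∉ S with hA
  set B : Finset V := S.filter fun v => ∃ a ∈ A, G.Adj a v with hB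
  have hlt : B.card < A.card := by
    refine hP.card_lt_card hG ⟨x, by simp [hA, hx, hxS]⟩ (fun a ha => ?_) ?_ (fun b hb => ?_) ?_
    · exact (Finset.mem_filter.1 ha).2.1
    · exact Finset.disjoint_left.2 fun a ha hb =>
        (Finset.mem_filter.1 ha).2.2 (Finset.mem_filter.1 hb).1
    · exact (Finset.mem_filter.1 hb).2
    · intro b hb z hz hbz
      refine Finset.mem_filter.2 ⟨Finset.mem_univ z, hz, fun hzS => ?_⟩
      exact hS.isIndepSet (Finset.mem_filter.1 hb).1 hzS hbz.ne hbz
  have hdisj : Disjoint (S \ B) A := Finset.disjoint_left.2 fun a ha hb =>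
    (Finset.mem_filter.1 hb).2.2 (Finset.mem_sdiff.1 ha).1
  have hno : ∀ u ∈ S \ B, ∀ a ∈ A, ¬ G.Adj a u := fun u hu a ha h =>
    (Finset.mem_sdiff.1 hu).2 (Finset.mem_filter.2 ⟨(Finset.mem_sdiff.1 hu).1, a, ha, h⟩)
  have hind : G.IsIndepSet ((S \ B ∪ A : Finset V) : Set V) := by
    intro u hu v hv huv hadj
    rw [Finset.mem_coe, Finset.mem_union] at hu hv
    rcases hu with hu | hu <;> rcases hv with hv | hv
    · exact hS.isIndepSet (Finset.mem_sdiff.1 hu).1 (Finset.mem_sdiff.1 hv).1 huv hadj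
    · exact hno u hu v hv hadj.symm
    · exact hno v hv u hu hadj
    · exact not_adj_of_mem_criticalSet (Finset.mem_filter.1 hu).2.1
        (Finset.mem_filter.1 hv).2.1 hadj
  have hcard := hind.card_le_indepNum
  rw [Finset.card_union_of_disjoint hdisj] at hcard
  have h1 : (S \ B).card + B.card = S.card :=
    Finset.card_sdiff_add_card_eq_card (Finset.filter_subset _ _)
  have h2 := hS.card_eq
  omega

theorem IsBalanced.isCritical (hG : ∀ x : V, ∃ y : V, G.Adj x y) (hP : IsBalanced G P)
    {x : V} (hx : x ∈ criticalSet G P) : IsCritical G x := by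
  classical
  obtain ⟨T, hT⟩ := (G.induce ({x}ᶜ : Set V)).exists_isNIndepSet_indepNum
  set S : Finset V := T.map (Function.Embedding.subtype _) with hS
  have hxS : x ∉ S := by simp [hS]
  have hind : G.IsIndepSet (S : Set V) := by
    intro u hu v hv huv hadj
    obtain ⟨u', hu', rfl⟩ := Finset.mem_map.1 (Finset.mem_coe.1 hu)
    obtain ⟨v', hv', rfl⟩ := Finset.mem_map.1 (Finset.mem_coe.1 hv)
    exact hT.isIndepSet hu' hv' (fun h => huv (by rw [h])) hadj
  have hcard : S.card = (G.induce ({x}ᶜ : Set V)).indepNum := by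
    rw [hS, Finset.card_map, hT.card_eq]
  refine (hcard ▸ hind.card_le_indepNum).lt_of_ne fun h => hxS ?_
  exact hP.mem_of_isNIndepSet hG ⟨hind, hcard.trans h⟩ hx

/-- A tight edge with an end outside `X ∪ ΓX`, where `X` is the set of the critical vertices, has
both ends there, and they have the same probability. -/
theorem IsBalanced.tight_of_not_mem (hG : ∀ x : V, ∃ y : V, G.Adj x y) (hP : IsBalanced G P)
    {x y : V} (hxy : G.Adj x y) (ht : hbar (P x) (P y) = edgeMin G P)
    (hx : x ∈ (criticalSet G P ∪ outerNbhd G (criticalSet G P))ᶜ) :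
    y ∈ (criticalSet G P ∪ outerNbhd G (criticalSet G P))ᶜ ∧ P x = P y := by
  have hpos := hP.pos hG
  have hx1 : x ∉ criticalSet G P := fun h => hx (.inl h)
  have hy1 : y ∉ criticalSet G P := fun h => hx (.inr ⟨hx1, y, h, hxy.symm⟩)
  have ht' := (hbar_comm (hpos y) (hpos x)).trans ht
  refine ⟨?_, ?_⟩
  · rintro (h | ⟨-, z, hz, hzy⟩)
    · exact hy1 h
    · exact hx1 (hP.mem_criticalSet_of_tight_of_adj hG hz hzy ht')
  · rcases lt_trichotomy (P x) (P y) with h | h | h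
    · exact (hx1 (hP.mem_criticalSet_of_tight hG ht h)).elim
    · exact h
    · exact (hy1 (hP.mem_criticalSet_of_tight hG ht' h)).elim

/-- Hall's condition outside `X ∪ ΓX`. -/
theorem IsBalanced.card_le_card_nbhd (hG : ∀ x : V, ∃ y : V, G.Adj x y) (hP : IsBalanced G P)
    {S N : Finset V}
    (hS : ∀ s ∈ S, s ∈ (criticalSet G P ∪ outerNbhd G (criticalSet G P))ᶜ)
    (hN : ∀ v ∈ N, v ∈ (criticalSet G P ∪ outerNbhd G (criticalSet G P))ᶜ)
    (hSN : ∀ s ∈ S, ∀ v ∈ (criticalSet G P ∪ outerNbhd G (criticalSet G P))ᶜ,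
      G.Adj s v → v ∈ N) : S.card ≤ N.card := by
  classical
  by_contra! hlt
  have hpos := hP.pos hG
  have hNS : (N.card : ℝ) + 1 ≤ S.card := by exact_mod_cast hlt
  obtain ⟨e, he0, heN⟩ : ∃ e : ℝ, 0 < e ∧ e * N.card < 1 := by
    refine ⟨((N.card : ℝ) + 1)⁻¹, by positivity, ?_⟩
    rw [inv_mul_lt_iff₀ (by positivity)]
    linarith
  -- `S` and `N` may overlap. The surplus `e` makes `Q x + Q y` strictly positive on tight edges
  -- meeting them, while `e * N.card < 1` keeps the total negative.
  set Q : V → ℝ := fun v => (if v ∈ N then 1 + e else 0) - if v ∈ S then 1 else 0 with hQ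
  have hsum := hP.sum_nonneg hG Q fun x y hxy ht => by
    by_cases h0 : x ∉ S ∧ y ∉ S ∧ x ∉ N ∧ y ∉ N
    · obtain ⟨h1, h2, h3, h4⟩ := h0
      exact .inl ⟨by simp [hQ, h1, h3], by simp [hQ, h2, h4]⟩
    right
    have ht' := (hbar_comm (hpos y) (hpos x)).trans ht
    have hx : x ∈ (criticalSet G P ∪ outerNbhd G (criticalSet G P))ᶜ := by
      have back := fun h => (hP.tight_of_not_mem hG hxy.symm ht' h).1
      by_contra hx
      exact h0 ⟨fun h => hx (hS x h), fun h => hx (back (hS y h)), fun h => hx (hN x h),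
        fun h => hx (back (hN y h))⟩
    obtain ⟨hy, heq⟩ := hP.tight_of_not_mem hG hxy ht hx
    have hQpos : 0 < Q x + Q y := by
      have h1 := fun h => hSN x h y hy hxy
      have h2 := fun h => hSN y h x hx hxy.symm
      simp only [hQ]
      by_cases hxS : x ∈ S <;> by_cases hyS : y ∈ S <;> by_cases hxN : x ∈ N <;>
        by_cases hyN : y ∈ N <;> simp_all <;> linarith
    -- Equal probabilities make the two logarithmic coefficients coincide.
    rw [← heq, ← add_mul]
    exact mul_pos hQpos (log_add_div_pos (hpos x) (hpos x))
  simp only [hQ, Finset.sum_sub_distrib, Finset.sum_ite_mem, Finset.univ_inter, Finset.sum_const,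
    nsmul_eq_mul, mul_one] at hsum
  linarith

end Balanced

/-! ### From Hall's condition to a perfect 2-matching -/

section TwoMatching

/-- A graph with a permutation of its vertices that moves each vertex to a neighbour has a perfect
2-matching: each vertex puts the weight `1/2` on the edge to its image. -/
theorem hasPerfectTwoMatching_of_perm {W : Type*} [Fintype W] (H : SimpleGraph W)
    (σ : Equiv.Perm W) (hσ : ∀ v, H.Adj v (σ v)) : HasPerfectTwoMatching H := by
  classical
  have key : ∀ v, incidentWeight H (fun e : H.edgeSet =>
      (1 / 2 : ℝ) * (Finset.univ.filter fun u => s(u, σ u) = (e : Sym2 W)).card) v = 1 := by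
    intro v
    -- The weight at `v` comes from `v` and its preimage, distinct because `σ` has no fixed point.
    have hne : v ≠ σ.symm v := fun h => (hσ v).ne (by
      conv_lhs => rw [h]
      conv_rhs => rw [h]
      rw [Equiv.apply_symm_apply, ← h])
    have hcond : ∀ u, (v = u ∨ v = σ u) ↔ u ∈ ({v, σ.symm v} : Finset W) := fun u => by
      rw [Finset.mem_insert, Finset.mem_singleton, Equiv.eq_symm_apply, eq_comm (a := u),
        eq_comm (a := σ u)]
    have inner : ∀ u : W, (∑ e : H.edgeSet,
        if v ∈ (e : Sym2 W) then (if s(u, σ u) = (e : Sym2 W) then (1 : ℝ) else 0) else 0) =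
        if u ∈ ({v, σ.symm v} : Finset W) then 1 else 0 := by
      intro u
      rw [Finset.sum_eq_single (⟨s(u, σ u), hσ u⟩ : H.edgeSet)]
      · simp only [Sym2.mem_iff, hcond, if_true]
      · intro e _ he
        have h : s(u, σ u) ≠ (e : Sym2 W) := fun h => he (Subtype.ext h.symm)
        rw [if_neg h, ite_self]
      · simp
    unfold incidentWeight
    rw [finsum_eq_sum_of_fintype]
    simp_rw [finsum_eq_if, Finset.card_filter, Nat.cast_sum, Nat.cast_ite, Nat.cast_one,
      Nat.cast_zero]
    calc _ = (1 / 2 : ℝ) * ∑ e : H.edgeSet, ∑ u : W,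
          (if v ∈ (e : Sym2 W) then (if s(u, σ u) = (e : Sym2 W) then (1 : ℝ) else 0) else 0) := by
          rw [Finset.mul_sum]
          refine Finset.sum_congr rfl fun e _ => ?_
          split_ifs <;> simp
      _ = 1 := by
          rw [Finset.sum_comm, Finset.sum_congr rfl fun u _ => inner u, Finset.sum_ite_mem,
            Finset.univ_inter, Finset.sum_const, Finset.card_pair hne]
          norm_num
  refine ⟨_, ⟨fun e => ?_, fun v => (key v).le⟩, key⟩
  have hle : (Finset.univ.filter fun u => s(u, σ u) = (e : Sym2 W)).card ≤ 2 := by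
    obtain ⟨e, he⟩ := e
    induction e with
    | _ a b =>
      refine (Finset.card_le_card fun u hu => ?_).trans (Finset.card_le_two (a := a) (b := b))
      have hu' : s(u, σ u) = s(a, b) := (Finset.mem_filter.1 hu).2
      have : u ∈ s(a, b) := hu' ▸ Sym2.mem_mk_left u (σ u)
      simpa using this
  interval_cases hc : (Finset.univ.filter fun u => s(u, σ u) = (e : Sym2 W)).card <;> norm_num

/-- Hall's theorem picks distinct neighbours for all vertices; by finiteness this injection is a
permutation. -/
theorem hasPerfectTwoMatching_of_hall {W : Type*} [Fintype W] (H : SimpleGraph W)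
    (h : ∀ S N : Finset W, (∀ s ∈ S, ∀ v, H.Adj s v → v ∈ N) → S.card ≤ N.card) :
    HasPerfectTwoMatching H := by
  classical
  obtain ⟨f, hf, hadj⟩ := (Finset.all_card_le_biUnion_card_iff_exists_injective
    fun v => H.neighborFinset v).1 fun S => h S _ fun s hs v hsv =>
      Finset.mem_biUnion.2 ⟨s, hs, (H.mem_neighborFinset s v).2 hsv⟩
  exact hasPerfectTwoMatching_of_perm H (Equiv.ofBijective f (Finite.injective_iff_bijective.1 hf))
    fun v => (H.mem_neighborFinset v _).1 (hadj v)

theorem IsBalanced.hasPerfectTwoMatching [Fintype V] {G : SimpleGraph V} {P : V → ℝ}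
    (hG : ∀ x : V, ∃ y : V, G.Adj x y) (hP : IsBalanced G P) :
    HasPerfectTwoMatching
      (G.induce (criticalSet G P ∪ outerNbhd G (criticalSet G P))ᶜ) := by
  classical
  refine hasPerfectTwoMatching_of_hall _ fun S N hSN => ?_
  rw [← Finset.card_map (Function.Embedding.subtype _),
    ← Finset.card_map (Function.Embedding.subtype _)]
  refine hP.card_le_card_nbhd hG (fun s hs => ?_) (fun s hs => ?_) fun s hs v hv hsv => ?_
  · obtain ⟨s', -, rfl⟩ := Finset.mem_map.1 hs
    exact s'.2
  · obtain ⟨s', -, rfl⟩ := Finset.mem_map.1 hs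
    exact s'.2
  · obtain ⟨s', hs', rfl⟩ := Finset.mem_map.1 hs
    exact Finset.mem_map.2 ⟨⟨v, hv⟩, hSN s' hs' ⟨v, hv⟩ hsv, rfl⟩

end TwoMatching

end SplittingLemma

theorem lemma1 {V : Type*} [Fintype V] (G : SimpleGraph V)
    (hG : ∀ x : V, ∃ y : V, G.Adj x y)
    (P : V → ℝ) (hP : SplittingLemma.IsBalanced G P) :
    (∀ x ∈ SplittingLemma.criticalSet G P, SplittingLemma.IsCritical G x) ∧
    SplittingLemma.HasPerfectTwoMatching
      (G.induce (SplittingLemma.criticalSet G P ∪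
        SplittingLemma.outerNbhd G (SplittingLemma.criticalSet G P))ᶜ) :=
  ⟨fun _ hx => hP.isCritical hG hx, hP.hasPerfectTwoMatching hG⟩
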